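/- **Setting.** Ranks are $0<1<2<\cdots<\vec\omega<\omega$. Let $G^\nu=\{X^0,B,X^1,\dots,X^\nu\}$ be a wconnected transfinite wgraph of rank $\nu$, $0\le\nu\le\omega$ (possibly $\nu=\vec\omega$). That is: $X^0\neq\emptyset$ is the set of $0$-nodes and $B$ is a set of branches (two-element subsets of $X^0$). For each rank $k\le\nu$ other than $0$ and $\vec\omega$, the set of $(k-1)$-wtips is partitioned into nonempty cells (where $\omega-1$ means $\vec\omega$). A $k$-wnode consists of one cell together with at most one wnode of lower rank, its exceptional element; no wnode is the exceptional element of two wnodes, and $X^k\ne\emptyset$. An $\vec\omega$-wnode is an infinite sequence of wnodes of natural-number ranks, the first having no exceptional element and each being the exceptional element of the next; $X^{\vec\omega}$ may be empty. A wnode embraces itself, its elements, their elements, and so on. Walks are alternating sequences of wnodes and walks of lower rank (or branches), which may repeat wnodes and branches; each piece reaches the wnode next to it through a wtip of that wnode or through an embraced wnode. A one-ended $0$-walk is an infinite sequence of branch traversals. For a natural number $k\geq 1$, a one-ended $k$-walk is an infinite sequence of traversals of branches and of one-ended walks of rank less than $k$ (outwards from the starting wnode, or inwards from the wtip), infinitely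 many of them of rank $k-1$. In a one-ended $\vec\omega$-walk these ranks are natural numbers and unbounded. A $k$-wtip is a class of one-ended $k$-walks, two of them being equivalent if they coincide after the deletion of initial portions. A two-ended walk is a finite succession of such traversals; its length is the natural sum of the lengths of these, taken with the coarsest such decomposition, where a branch has length $1$, a one-ended $k$-walk has length $\omega^{k+1}$ and a one-ended $\vec\omega$-walk has length $\omega^\omega$. It has rank at most $\rho$ if all wtips traversed have rank less than $\rho$. The wdistance $d(x,y)$ is the least length of a two-ended walk terminating at $x$ and $y$ (or at wnodes that embrace, or are embraced by, $x$ and $y$); $d(x,y)=0$ if some wnode embraces both. Wconnected means that any two wnodes are joined by a two-ended walk. Let $\rho\le\nu$ be a natural number or $\omega$, and let $S^\rho$ be a $\rho$-wsection of $G^\nu$: a maximal wsubgraph, consisting of wnodes of ranks at most $\rho$ and the branches between its $0$-nodes, any two wnodes of which are joined by a two-ended walk of rank at most $\rho$. Fix a free ultrafilter $\mathcal F$ on $\mathbb N$. The enlargement ${}^*S^\rho$ has as hypernodes of rank $\alpha\le\rho$ the classes $\mathbf x=[x_n]$ modulo $\mathcal F$ of sequences of $\alpha$-wnodes of $S^\rho$,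 and as hyperbranches the classes of sequences of branches of $S^\rho$; $\mathbf x$ is standard if it is the class of a constant sequence. Hypernodes $\mathbf x,\mathbf y$ of any ranks are $\rho$-limitedly distant if $\{n: d(x_n,y_n)\le\omega^\rho\cdot m\}\in\mathcal F$ for some $m\in\mathbb N$; this is an equivalence relation. A $\rho$-galaxy of ${}^*S^\rho$ is one of its equivalence classes together with the hyperbranches whose incident $0$-hypernodes are in the class. The principal $\rho$-galaxy $\Gamma_0^\rho$ is the one whose hypernodes are $\rho$-limitedly distant from a standard hypernode. For $\rho$-galaxies $\Gamma_a,\Gamma_b$ different from $\Gamma^\rho_0$, $\Gamma_a$ is closer to $\Gamma_0^\rho$ than is $\Gamma_b$ if there are hypernodes $\mathbf x\in\Gamma_0^\rho$, $\mathbf y\in\Gamma_a$, $\mathbf z\in\Gamma_b$, of ranks other than $\vec\omega$, such that for every $m\in\mathbb N$ $$\{n: d(z_n,x_n)\ \ge\ d(y_n,x_n)+\omega^\rho\cdot m\}\in\mathcal F ,$$ where $+$ is the natural sum of ordinals. **Theorem 5.1.** Suppose that ${}^*S^\rho$ has a hypernode $\mathbf v$, of any rank $\alpha\le\rho$, that is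 not in $\Gamma_0^\rho$. Then there are pairwise distinct $\rho$-galaxies $\Gamma_i$ $(i\in\mathbb Z)$ of ${}^*S^\rho$, all different from $\Gamma_0^\rho$, such that $\Gamma_i$ is closer to $\Gamma_0^\rho$ than is $\Gamma_j$ if and only if $i<j$, and such that $\mathbf v$ is in one of the $\Gamma_i$. Consequently, without any assumption on hypernodes outside $\Gamma_0^\rho$, ${}^*S^\rho$ either has exactly one $\rho$-galaxy, namely $\Gamma_0^\rho$, or has infinitely many $\rho$-galaxies. -/

import Mathlib

universe u

namespace WTheory

noncomputable section

open Ordinal Filter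

/-! ## Ranks and natural sums of ordinals -/

/-- The ranks `0 < 1 < 2 < ⋯ < ω⃗ < ω`: a natural number `n` is `((n : ℕ∞) : Rank)`, the arrow rank
`ω⃗` is `((⊤ : ℕ∞) : Rank)`, and `ω` is `(⊤ : Rank)`. -/
abbrev Rank : Type := WithTop ℕ∞

/-- The arrow rank `ω⃗`. -/
def Rank.arrow : Rank := ((⊤ : ℕ∞) : Rank)

/-- The ranks different from `ω⃗` are indexed by `ℕ∞`: natural numbers go to themselves, and `⊤`
goes to the rank `ω`. -/
def Rank.ofIdx (k : ℕ∞) : Rank := ENat.recTopCoe (⊤ : Rank) (fun n : ℕ => ((n : ℕ∞) : Rank)) k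

/-- A natural number or `⊤`, read as the ordinal `n` or `ω`. -/
def idxOrd (k : ℕ∞) : Ordinal.{0} := ENat.recTopCoe ω (fun n : ℕ => (n : Ordinal.{0})) k

/-- The natural (Hessenberg) sum: the coefficients of the Cantor normal forms to base `ω` are
added. -/
def natSum (a b : Ordinal.{0}) : Ordinal.{0} := CNF.eval ω (CNF.coeff ω a + CNF.coeff ω b)

/-! ## Pieces of walks

A two-ended walk is a finite concatenation of *pieces*. A piece is either the traversal of one
branch, or the traversal of a one-ended walk, from its starting wnode out through its wtip or
inwards from its wtip to its starting wnode. (An endless walk is an inward piece followed by an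
outward one.) A one-ended walk is an infinite sequence of pieces of lower level. The *level* of a
branch is `0`, the level of a one-ended walk of rank `n` is `n + 1`, and that of a one-ended
`ω⃗`-walk is `⊤`; thus a piece of level `k` carries a `(k - 1)`-wtip (the ends of a branch being
`(-1)`-tips, and `ω - 1` being `ω⃗`), and reaches a wnode of rank `k` through that wtip. -/

/-- Raw pieces over the set `V` of `0`-nodes. `tip true W` is the one-ended walk
`W 0, W 1, W 2, …` traversed outwards, `tip false W` is the same walk traversed inwards. -/
inductive Piece (V : Type u) : Type u
  | branch (v w : V) : Piece V
  | tip (out : Bool) (W : ℕ → Piece V) : Piece V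

namespace Piece

variable {V : Type u}

/-- The level of a piece. If all `W n` have natural levels at most `j` and level `j` occurs
infinitely often, the level of `tip d W` is `j + 1`; if the natural levels of the `W n` are
unbounded, it is `⊤`. -/
def level : Piece V → ℕ∞
  | branch _ _ => 0
  | tip _ W => limsup (fun n => level (W n)) atTop + 1

/-- The branch traversals that make up a piece. -/
def Traversal : Piece V → Type
  | branch _ _ => Unit
  | tip _ W => Σ n, Traversal (W n)

/-- `p.Before i j`: the traversal `i` occurs before the traversal `j` along `p`. -/
def Before : (p : Piece V) → p.Traversal → p.Traversal → Prop
  | branch _ _, _, _ => False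
  | tip true W, i, j =>
      Sigma.Lex (· < ·) (fun n => Before (W n)) (i : Σ n, Traversal (W n)) j
  | tip false W, i, j =>
      Sigma.Lex (· < ·) (fun n => Before (W n)) (j : Σ n, Traversal (W n)) i

/-- The initial and final `0`-node of a branch traversal along a piece. -/
def dart : (p : Piece V) → p.Traversal → V × V
  | branch v w, _ => (v, w)
  | tip true W, i =>
      let i : Σ n, Traversal (W n) := i
      dart (W i.1) i.2
  | tip false W, i =>
      let i : Σ n, Traversal (W n) := i
      (dart (W i.1) i.2).swap

end Piece

/-- Two one-ended walks are equivalent, that is, they represent the same wtip, if after the deletion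
of suitable initial portions they traverse the same branches in the same order. -/
def SameTail {V : Type u} (W W' : ℕ → Piece V) : Prop :=
  ∃ (a : (Piece.tip true W).Traversal) (b : (Piece.tip true W').Traversal)
    (f : {i // ¬ (Piece.tip true W).Before i a} ≃ {j // ¬ (Piece.tip true W').Before j b}),
    (∀ i j, (Piece.tip true W).Before i.1 j.1 ↔ (Piece.tip true W').Before (f i).1 (f j).1) ∧
    ∀ i, (Piece.tip true W).dart i.1 = (Piece.tip true W').dart (f i).1

/-! ## Wnodes and wgraphs -/

/-- The wnodes whose rank `k` is a natural number or `ω`, with the relation `exc y x`: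
the wnode `y`, of natural rank, is the exceptional element of the wnode `x` of higher rank. -/
structure NodeData where
  Node : ℕ∞ → Type u
  exc : (Σ k, Node k) → (Σ k, Node k) → Prop

/-- An `ω⃗`-wnode: an infinite sequence of wnodes of natural ranks, the first of which has no
exceptional element, each of which is the exceptional element of the next one. -/
structure NodeData.ArrowNode (D : NodeData.{u}) where
  seq : ℕ → Σ k, D.Node k
  natural : ∀ i, (seq i).1 ≠ ⊤
  bottom : ∀ y, ¬ D.exc y (seq 0)
  chain : ∀ i, D.exc (seq i) (seq (i + 1))

/-- All wnodes: those of natural rank or rank `ω`, and those of rank `ω⃗`. -/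
inductive NodeData.WNode (D : NodeData.{u}) : Type u
  | plain (x : Σ k, D.Node k) : D.WNode
  | arrow (c : D.ArrowNode) : D.WNode

/-- The rank of a wnode. -/
def NodeData.WNode.rank {D : NodeData.{u}} : D.WNode → Rank
  | .plain x => Rank.ofIdx x.1
  | .arrow _ => Rank.arrow

/-- The raw data of a wgraph: wnodes, branches (two-element sets of `0`-nodes), the relation
`excArrow c x`: the `ω⃗`-wnode `c` is the exceptional element of the `ω`-wnode `x`, and the relation
`tip k W x`: the wtip with the representative `W` is an element of the wnode `x` of rank `k`. -/
structure PreWGraph extends NodeData.{u} where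
  branches : SimpleGraph (Node 0)
  excArrow : toNodeData.ArrowNode → Node ⊤ → Prop
  tip : (k : ℕ∞) → (ℕ → Piece (Node 0)) → Node k → Prop

namespace PreWGraph

variable (A : PreWGraph.{u})

/-- `A.Elem y x`: the wnode `y` is an element of the wnode `x`. -/
inductive Elem : A.WNode → A.WNode → Prop
  | exc (y x : Σ k, A.Node k) : A.exc y x → Elem (.plain y) (.plain x)
  | chain (c : A.ArrowNode) (i : ℕ) : Elem (.plain (c.seq i)) (.arrow c)
  | excArrow (c : A.ArrowNode) (x : A.Node ⊤) : A.excArrow c x → Elem (.arrow c) (.plain ⟨⊤, x⟩)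

/-- `A.Embraces x y`: the wnode `x` embraces the wnode `y`; every wnode embraces itself, its
elements, the elements of its elements, and so on. -/
def Embraces (x y : A.WNode) : Prop := Relation.ReflTransGen A.Elem y x

/-- Two wnodes are shorted together if some wnode embraces both of them. -/
def Shorted (x y : A.WNode) : Prop := ∃ z, A.Embraces z x ∧ A.Embraces z y

/-- `A.EndsAt p e x`: the piece `p` ends (for `e = true`) or starts (for `e = false`) at the wnode
`x`. The end of a one-ended walk is the wnode that contains its wtip. -/
def EndsAt : Piece (A.Node 0) → Bool → A.WNode → Prop
  | .branch v w, e, x => x = .plain ⟨0, if e then w else v⟩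
  | .tip d W, e, x =>
      (e = d ∧ ∃ (k : ℕ∞) (y : A.Node k), A.tip k W y ∧ x = .plain ⟨k, y⟩) ∨
      (e ≠ d ∧ EndsAt (W 0) false x)

/-- The piece `q` can follow the piece `p` in a walk: `p` ends where `q` starts. -/
def Joined (p q : Piece (A.Node 0)) : Prop :=
  ∃ x y, A.EndsAt p true x ∧ A.EndsAt q false y ∧ A.Shorted x y

/-- The pieces that really are traversals of branches or of one-ended walks in `A`. In a one-ended
walk of level `j + 1` all pieces have level at most `j`, and infinitely many have level `j`; in one
of level `⊤` all pieces have natural levels, which are unbounded. -/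
def Valid : Piece (A.Node 0) → Prop
  | .branch v w => A.branches.Adj v w
  | .tip d W =>
      (∀ n, Valid (W n)) ∧ (∀ n, A.Joined (W n) (W (n + 1))) ∧
      ∀ n, (W n).level < (Piece.tip d W).level

/-- `W` is a one-ended walk of level `k`, hence of rank `k - 1`, so that it represents a
`(k - 1)`-wtip (where `ω - 1` is `ω⃗`). -/
def IsOneEnded (k : ℕ∞) (W : ℕ → Piece (A.Node 0)) : Prop :=
  A.Valid (.tip true W) ∧ (Piece.tip true W).level = k

/-- `A.IsWalk ρ x y l`: the list `l` of pieces is a two-ended walk of rank at most `ρ` that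
terminates at the wnodes `x` and `y`. The trivial walk is the empty list. -/
def IsWalk (ρ : ℕ∞) (x y : A.WNode) : List (Piece (A.Node 0)) → Prop
  | [] => A.Shorted x y
  | p :: l => A.Valid p ∧ p.level ≤ ρ ∧
      ∃ a b, A.EndsAt p false a ∧ A.EndsAt p true b ∧ A.Shorted x a ∧ IsWalk ρ b y l

end PreWGraph

/-- The length of a two-ended walk that is given as a list of pieces: the natural sum of the lengths
of its pieces, a branch having length `1 = ω ^ 0`, a one-ended `n`-walk having length `ω ^ (n + 1)`
and a one-ended `ω⃗`-walk having length `ω ^ ω`. (If the same walk is cut into pieces in several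
ways, cutting off part of a one-ended walk only adds to this sum; the shortest sum is the length of
the walk.) -/
def walkLength {V : Type u} (l : List (Piece V)) : Ordinal.{0} :=
  (l.map fun p => ω ^ idxOrd p.level).foldr natSum 0

namespace PreWGraph

variable (A : PreWGraph.{u})

/-- The wdistance between two wnodes: the least length of a two-ended walk that terminates at
them. -/
def wdist (x y : A.WNode) : Ordinal.{0} :=
  sInf {o | ∃ l, A.IsWalk ⊤ x y l ∧ o = walkLength l}

/-- Any two wnodes in `S` are joined by a two-ended walk of rank at most `ρ`. -/
def WConnectedOn (ρ : ℕ∞) (S : Set A.WNode) : Prop :=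
  ∀ x ∈ S, ∀ y ∈ S, ∃ l, A.IsWalk ρ x y l

/-- `S` is (the set of wnodes of) a `ρ`-wsection: a maximal `ρ`-wconnected wsubgraph of the
`ρ`-wgraph that consists of the branches and the wnodes of ranks at most `ρ`. Its branches are the
branches between its `0`-nodes. -/
def IsWSection (ρ : ℕ∞) (S : Set A.WNode) : Prop :=
  S.Nonempty ∧
  Maximal (fun T : Set A.WNode => (∀ x ∈ T, x.rank ≤ Rank.ofIdx ρ) ∧ A.WConnectedOn ρ T) S

end PreWGraph

/-- A wconnected transfinite wgraph of rank `ν`, where `0 ≤ ν ≤ ω`, possibly `ν = ω⃗`. For every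
rank `k ≤ ν` other than `0` and `ω⃗` the set of `(k - 1)`-wtips is partitioned into nonempty sets;
the `k`-wnodes correspond to the cells of this partition, and a `k`-wnode has, besides the wtips of
its cell, at most one further element, a wnode of lower rank, which is an element of no other wnode
in this way. -/
structure WGraph (ν : Rank) extends PreWGraph.{u} where
  nonempty_iff : ∀ k, Nonempty (Node k) ↔ Rank.ofIdx k ≤ ν
  exc_rank : ∀ y x, exc y x → y.1 < x.1
  exc_unique : ∀ y y' x, exc y x → exc y' x → y = y'
  exc_disjoint : ∀ y x x', exc y x → exc y x' → x = x'
  excArrow_unique : ∀ c c' x, excArrow c x → excArrow c' x → c = c'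
  excArrow_disjoint : ∀ c x x', excArrow c x → excArrow c x' → x = x'
  excArrow_exc : ∀ c y x, excArrow c x → ¬ exc y ⟨⊤, x⟩
  tip_isOneEnded : ∀ k W x, tip k W x → toPreWGraph.IsOneEnded k W
  tip_existsUnique : ∀ k W, Rank.ofIdx k ≤ ν → toPreWGraph.IsOneEnded k W → ∃! x, tip k W x
  tip_congr : ∀ k W W' x, SameTail W W' → toPreWGraph.IsOneEnded k W' → tip k W x → tip k W' x
  exists_tip : ∀ k (x : Node k), k ≠ 0 → ∃ W, tip k W x
  wconnected : ∀ x y : toPreWGraph.WNode, ∃ l, toPreWGraph.IsWalk ⊤ x y l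

/-! ## The enlargement of a wsection -/

section Enlargement

variable {A : PreWGraph.{u}} (F : Ultrafilter ℕ) (S : Set A.WNode)

/-- The hypernodes of rank `α` in the enlargement of `S`: the classes of sequences of wnodes of rank
`α` in `S` modulo the ultrafilter `F`. -/
abbrev HyperNodeOf (α : Rank) : Type u :=
  (F : Filter ℕ).Germ {x : A.WNode // x ∈ S ∧ x.rank = α}

/-- The hypernodes, of all ranks, in the enlargement of `S`. -/
abbrev HyperNode : Type u := Σ α : Rank, HyperNodeOf F S α

/-- The hyperbranches in the enlargement of `S`. -/
abbrev HyperBranch : Type u :=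
  (F : Filter ℕ).Germ
    {e : Sym2 (A.Node 0) // e ∈ A.branches.edgeSet ∧ ∀ v ∈ e, NodeData.WNode.plain ⟨0, v⟩ ∈ S}

variable {F S}

/-- The hypernode `x` is a `0`-hypernode and is incident to the hyperbranch `b`. -/
def Incident (b : HyperBranch F S) (x : HyperNode F S) : Prop :=
  Filter.Germ.LiftRel
    (fun e y => ∃ v ∈ e.1, y.1 = NodeData.WNode.plain ⟨0, v⟩) b x.2

/-- The standard hypernodes are the classes of constant sequences. -/
def IsStandard (x : HyperNode F S) : Prop := ∃ y, x.2 = Filter.Germ.const y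

/-- The hyperordinal-valued hyperdistance `[d(x_n, y_n)]` between `[x_n]` and `[y_n]`. -/
def hyperDist (x y : HyperNode F S) : (F : Filter ℕ).Germ Ordinal.{0} :=
  Filter.Germ.map₂ (fun a b => A.wdist a.1 b.1) x.2 y.2

/-- `x` and `y` are `ρ`-limitedly distant: `d(x_n, y_n) ≤ ω ^ ρ * m` for almost all `n`, for some
natural number `m`. -/
def LimitedlyDistant (ρ : ℕ∞) (x y : HyperNode F S) : Prop :=
  ∃ m : ℕ, hyperDist x y ≤ Filter.Germ.const (ω ^ idxOrd ρ * (m : Ordinal.{0}))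

variable (F S)

/-- A set of hypernodes together with a set of hyperbranches. -/
@[ext] structure HyperSubgraph : Type u where
  nodes : Set (HyperNode F S)
  hyperbranches : Set (HyperBranch F S)

variable {F S}

/-- The nonstandard wsubgraph induced by a set `N` of hypernodes: its hyperbranches are those whose
incident `0`-hypernodes are in `N`. -/
def inducedBy (N : Set (HyperNode F S)) : HyperSubgraph F S where
  nodes := N
  hyperbranches := {b | ∀ x, Incident b x → x ∈ N}

/-- `Γ` is a `ρ`-galaxy: it is induced by a nodal `ρ`-galaxy, that is, by an equivalence class of
the relation of being `ρ`-limitedly distant. -/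
def IsGalaxy (ρ : ℕ∞) (Γ : HyperSubgraph F S) : Prop :=
  ∃ x, Γ = inducedBy {y | LimitedlyDistant ρ x y}

variable (F S)

/-- The principal `ρ`-galaxy: its hypernodes are those that are `ρ`-limitedly distant from a standard
hypernode. -/
def principalGalaxy (ρ : ℕ∞) : HyperSubgraph F S :=
  inducedBy {y | ∃ x, IsStandard x ∧ LimitedlyDistant ρ x y}

variable {F S}

/-- `Γa` is closer to the principal `ρ`-galaxy than is `Γb`, where `Γa` and `Γb` are `ρ`-galaxies
different from the principal one. The inequality `d(z_n, x_n) - d(y_n, x_n) ≥ ω ^ ρ * m` for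
almost all `n` is written with a natural sum instead of a difference of ordinals. -/
def Closer (ρ : ℕ∞) (Γa Γb : HyperSubgraph F S) : Prop :=
  IsGalaxy ρ Γa ∧ IsGalaxy ρ Γb ∧ Γa ≠ principalGalaxy F S ρ ∧ Γb ≠ principalGalaxy F S ρ ∧
  ∃ x ∈ (principalGalaxy F S ρ).nodes, ∃ y ∈ Γa.nodes, ∃ z ∈ Γb.nodes,
    x.1 ≠ Rank.arrow ∧ y.1 ≠ Rank.arrow ∧ z.1 ≠ Rank.arrow ∧
    ∀ m : ℕ, Filter.Germ.map (fun o => natSum o (ω ^ idxOrd ρ * (m : Ordinal.{0})))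
      (hyperDist y x) ≤ hyperDist z x

end Enlargement

end

end WTheory

/-! Inside the wsection `S` two wnodes are joined by finitely many pieces of level at most `ρ`, each
of length at most `ω ^ ρ`. Measured in units of `ω ^ ρ` and rounded up, the wdistance on `S` is
therefore a natural number, `scaledDist`. The natural sum adds coefficients, so rounding up
preserves the triangle inequality (`natSum_le_opow_mul`, `scaledDist_triangle`). Galaxies are thus
classes at finite distance for an ℕ-valued pseudometric, and the principal one consists of the
hypernodes at limited distance from one fixed `0`-node `o`.

Two facts about `S` carry the proof. One piece changes the distance from `o` by at most one unit,
and the wnodes between pieces stay in `S` by maximality, so a walk from `o` realises all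
intermediate distances (`exists_scaledDist_eq_of_isWalk`). Every wnode of `S` is within two units of
a `0`-node of `S` (`exists_zero_node_near`). Hence below any attained distance, every distance from
`o` is attained by a `0`-node up to an error of 2.

If `v` is not in the principal galaxy, the distances `K n` from `o` to `v n` are unlimited. The
targets `⌊K n * 2 ^ i⌋` with `i : ℤ` are then unlimited, with unlimited gaps between different `i`.
The galaxies of `0`-hypernodes near these targets form the chain, since for them `Closer` means an
unlimited gap (`closer_galaxyOf_iff`). For `i = 0` the `0`-nodes are taken close to `v` itself. -/

namespace WTheory

open Ordinal Filter

/-! ## Natural sums -/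

theorem idxOrd_top : idxOrd ⊤ = ω := rfl

theorem idxOrd_natCast (n : ℕ) : idxOrd (n : ℕ∞) = n := rfl

theorem idxOrd_strictMono : StrictMono idxOrd := by
  intro a b hab
  induction a using ENat.recTopCoe with
  | top => exact absurd hab not_top_lt
  | coe m =>
    induction b using ENat.recTopCoe with
    | top => rw [idxOrd_top, idxOrd_natCast]; exact natCast_lt_omega0 m
    | coe n => rw [idxOrd_natCast, idxOrd_natCast]; exact_mod_cast hab

theorem coeff_omega0_lt (a e : Ordinal.{0}) : CNF.coeff ω a e < ω := by
  by_cases h : e ∈ (CNF ω a).map Prod.fst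
  · obtain ⟨⟨e, c⟩, he, rfl⟩ := List.mem_map.1 h
    rw [CNF.coeff_of_mem_CNF he]
    exact CNF.snd_lt one_lt_omega0 he
  · rw [CNF.coeff_of_notMem_CNF h]
    exact omega0_pos

/-- Coefficients to base `ω` are finite, so their sums stay below `ω` and again form a normal form.
This reduces natural sums to coefficientwise addition. -/
theorem coeff_natSum (a b : Ordinal.{0}) :
    CNF.coeff ω (natSum a b) = CNF.coeff ω a + CNF.coeff ω b :=
  CNF.coeff_eval one_lt_omega0 fun e =>
    isPrincipal_add_omega0 (coeff_omega0_lt a e) (coeff_omega0_lt b e)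

theorem natSum_comm (a b : Ordinal.{0}) : natSum a b = natSum b a := by
  unfold natSum
  congr 1
  ext e
  obtain ⟨m, hm⟩ := lt_omega0.1 (coeff_omega0_lt a e)
  obtain ⟨n, hn⟩ := lt_omega0.1 (coeff_omega0_lt b e)
  rw [Finsupp.add_apply, Finsupp.add_apply, hm, hn]
  exact_mod_cast add_comm m n

theorem natSum_assoc (a b c : Ordinal.{0}) :
    natSum (natSum a b) c = natSum a (natSum b c) := by
  apply CNF.coeff_injective ω
  rw [coeff_natSum, coeff_natSum, coeff_natSum, coeff_natSum, add_assoc]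

theorem natSum_zero (a : Ordinal.{0}) : natSum a 0 = a := by
  simp [natSum]

theorem zero_natSum (a : Ordinal.{0}) : natSum 0 a = a := by
  simp [natSum]

theorem natSum_lt_opow {e a b : Ordinal.{0}} (ha : a < ω ^ e) (hb : b < ω ^ e) :
    natSum a b < ω ^ e := by
  refine CNF.eval_lt (fun e' => isPrincipal_add_omega0 (coeff_omega0_lt a e') (coeff_omega0_lt b e'))
    fun e' he' => ?_
  by_contra! h
  have h' : (ω : Ordinal.{0}) ^ e ≤ ω ^ e' := opow_le_opow_right omega0_pos h
  rw [Finsupp.mem_support_iff, Finsupp.add_apply, CNF.coeff_eq_zero_of_lt (ha.trans_le h'),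
    CNF.coeff_eq_zero_of_lt (hb.trans_le h')] at he'
  simp at he'

theorem coeff_opow_mul_natCast_add {e r : Ordinal.{0}} (k : ℕ) (hr : r < ω ^ e) :
    CNF.coeff ω (ω ^ e * k + r) = Finsupp.single e (k : Ordinal.{0}) + CNF.coeff ω r := by
  obtain rfl | hk := Nat.eq_zero_or_pos k
  · simp
  · exact CNF.coeff_opow_mul_add one_lt_omega0 (by exact_mod_cast hk.ne') (natCast_lt_omega0 k) hr

/-- The natural sum of two ordinals below `ω ^ (e + 1)` adds the leading coefficients. -/
theorem natSum_opow_mul_add {e r s : Ordinal.{0}} (k l : ℕ) (hr : r < ω ^ e) (hs : s < ω ^ e) :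
    natSum (ω ^ e * k + r) (ω ^ e * l + s) = ω ^ e * ((k + l : ℕ) : Ordinal.{0}) + natSum r s := by
  apply CNF.coeff_injective ω
  rw [coeff_natSum, coeff_opow_mul_natCast_add k hr, coeff_opow_mul_natCast_add l hs,
    coeff_opow_mul_natCast_add _ (natSum_lt_opow hr hs), coeff_natSum]
  ext e'
  simp only [Finsupp.add_apply]
  obtain rfl | h := eq_or_ne e e'
  · simp [CNF.coeff_eq_zero_of_lt hr, CNF.coeff_eq_zero_of_lt hs]
  · simp [Finsupp.single_eq_of_ne' h]

theorem exists_opow_mul_add {e o : Ordinal.{0}} {a : ℕ} (h : o ≤ ω ^ e * a) :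
    ∃ (k : ℕ) (r : Ordinal.{0}), r < ω ^ e ∧ o = ω ^ e * k + r ∧ (k < a ∨ k = a ∧ r = 0) := by
  have hpos : (ω : Ordinal.{0}) ^ e ≠ 0 := (opow_pos e omega0_pos).ne'
  have hk : o / ω ^ e ≤ a := by
    have := Ordinal.div_le_of_le_mul h
    exact this
  obtain ⟨k, hk'⟩ := lt_omega0.1 (hk.trans_lt (natCast_lt_omega0 a))
  have ho : o = ω ^ e * k + o % ω ^ e := by rw [← hk', Ordinal.div_add_mod]
  refine ⟨k, o % ω ^ e, Ordinal.mod_lt _ hpos, ho, ?_⟩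
  rw [hk', Nat.cast_le] at hk
  obtain hlt | rfl := hk.lt_or_eq
  · exact Or.inl hlt
  · refine Or.inr ⟨rfl, ?_⟩
    rw [ho] at h
    simpa using h

theorem opow_mul_natCast_le_iff {e : Ordinal.{0}} {a b : ℕ} :
    (ω : Ordinal.{0}) ^ e * a ≤ ω ^ e * b ↔ a ≤ b := by
  rw [mul_le_mul_iff_right₀ (opow_pos e omega0_pos), Nat.cast_le]

/-- If the quotients by `ω ^ e` do not both attain their bounds, there is a spare unit to absorb the
remainders; if they do, the remainders vanish. -/
theorem natSum_le_opow_mul {e o o' : Ordinal.{0}} {a a' : ℕ} (h : o ≤ ω ^ e * a)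
    (h' : o' ≤ ω ^ e * a') : natSum o o' ≤ ω ^ e * ((a + a' : ℕ) : Ordinal.{0}) := by
  obtain ⟨k, r, hr, rfl, hk⟩ := exists_opow_mul_add h
  obtain ⟨k', r', hr', rfl, hk'⟩ := exists_opow_mul_add h'
  rw [natSum_opow_mul_add k k' hr hr']
  by_cases hlt : k + k' < a + a'
  · calc ω ^ e * ((k + k' : ℕ) : Ordinal.{0}) + natSum r r'
        ≤ ω ^ e * ((k + k' : ℕ) : Ordinal.{0}) + ω ^ e := by
          gcongr; exact (natSum_lt_opow hr hr').le
      _ = ω ^ e * ((k + k' + 1 : ℕ) : Ordinal.{0}) := by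
          rw [Nat.cast_succ, mul_add_one]
      _ ≤ _ := opow_mul_natCast_le_iff.2 hlt
  · have hk1 : k = a ∧ r = 0 := hk.resolve_left fun _ => by omega
    have hk2 : k' = a' ∧ r' = 0 := hk'.resolve_left fun _ => by omega
    rw [hk1.1, hk1.2, hk2.1, hk2.2, natSum_zero, add_zero]

/-- The bound `hb` makes the quotient of `o` by `ω ^ e` finite, so that the natural sum just adds
`m` to it. -/
theorem opow_mul_le_natSum {e o : Ordinal.{0}} {a b : ℕ} (hb : o ≤ ω ^ e * b)
    (h : ω ^ e * a ≤ o) (m : ℕ) :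
    ω ^ e * ((a + m : ℕ) : Ordinal.{0}) ≤ natSum o (ω ^ e * m) := by
  obtain ⟨k, r, hr, rfl, -⟩ := exists_opow_mul_add hb
  have hak : a ≤ k := by
    by_contra! hlt
    have h1 : (ω : Ordinal.{0}) ^ e * ((k + 1 : ℕ) : Ordinal.{0}) ≤ ω ^ e * k + r :=
      (opow_mul_natCast_le_iff.2 hlt).trans h
    rw [Nat.cast_succ, mul_add_one] at h1
    exact (le_of_add_le_add_left h1).not_gt hr
  have := natSum_opow_mul_add k m hr (opow_pos e omega0_pos)
  rw [add_zero, natSum_zero] at this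
  rw [this]
  exact (opow_mul_natCast_le_iff.2 (by omega)).trans le_self_add

/-! ## Walk lengths -/

section WalkLength

variable {V : Type u}

theorem walkLength_nil : walkLength ([] : List (Piece V)) = 0 := rfl

theorem walkLength_cons (p : Piece V) (l : List (Piece V)) :
    walkLength (p :: l) = natSum (ω ^ idxOrd p.level) (walkLength l) := rfl

theorem walkLength_append (l l' : List (Piece V)) :
    walkLength (l ++ l') = natSum (walkLength l) (walkLength l') := by
  induction l with
  | nil => rw [List.nil_append, walkLength_nil, zero_natSum]
  | cons p l ih => rw [List.cons_append, walkLength_cons, walkLength_cons, ih, natSum_assoc]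

theorem walkLength_le {ρ : ℕ∞} {l : List (Piece V)} (h : ∀ p ∈ l, p.level ≤ ρ) :
    walkLength l ≤ ω ^ idxOrd ρ * (l.length : Ordinal.{0}) := by
  induction l with
  | nil => simp [walkLength_nil]
  | cons p l ih =>
    have hp : (ω : Ordinal.{0}) ^ idxOrd p.level ≤ ω ^ idxOrd ρ * (1 : ℕ) := by
      rw [Nat.cast_one, mul_one]
      exact opow_le_opow_right omega0_pos
        (idxOrd_strictMono.monotone (h p List.mem_cons_self))
    rw [walkLength_cons, List.length_cons, add_comm]
    exact natSum_le_opow_mul hp (ih fun q hq => h q (List.mem_cons_of_mem _ hq))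

/-- The same traversal in the opposite direction. -/
def Piece.reverse : Piece V → Piece V
  | .branch v w => .branch w v
  | .tip d W => .tip (!d) W

theorem Piece.level_reverse (p : Piece V) : p.reverse.level = p.level := by
  cases p <;> simp [Piece.reverse, Piece.level]

theorem Piece.level_tip (d d' : Bool) (W : ℕ → Piece V) :
    (Piece.tip d W).level = (Piece.tip d' W).level := by
  simp [Piece.level]

end WalkLength

/-! ## The relation of being shorted together -/

namespace WGraph

variable {ν : Rank} (G : WGraph.{u} ν)

/-- Uniqueness of exceptional elements lets both chains be followed down to their bottoms, which
forces equal indices; disjointness then identifies the chains upwards. -/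
theorem arrowNode_eq {c c' : G.ArrowNode} : ∀ {i i' : ℕ}, c.seq i = c'.seq i' → i = i' ∧ c = c'
  | 0, 0, h => by
    have hseq : ∀ j, c.seq j = c'.seq j := by
      intro j
      induction j with
      | zero => exact h
      | succ j ih => exact G.exc_disjoint _ _ _ (c.chain j) (ih ▸ c'.chain j)
    refine ⟨rfl, ?_⟩
    cases c
    cases c'
    congr
    exact funext hseq
  | 0, i' + 1, h => absurd (h ▸ c'.chain i') (c.bottom _)
  | i + 1, 0, h => absurd (h ▸ c.chain i) (c'.bottom _)
  | i + 1, i' + 1, h => by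
    obtain ⟨h1, h2⟩ := arrowNode_eq (G.exc_unique _ _ _ (c.chain i) (h ▸ c'.chain i'))
    exact ⟨by rw [h1], h2⟩

/-- A wnode that embraces a term of an `ω⃗`-wnode is a later term or embraces the `ω⃗`-wnode. -/
theorem embraces_seq {c : G.ArrowNode} {i : ℕ} {z : G.WNode}
    (h : G.Embraces z (.plain (c.seq i))) :
    (∃ j, z = .plain (c.seq j)) ∨ G.Embraces z (.arrow c) := by
  induction h with
  | refl => exact Or.inl ⟨i, rfl⟩
  | @tail y z _ hyz ih =>
    obtain ⟨j, rfl⟩ | hy := ih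
    · generalize hs : NodeData.WNode.plain (c.seq j) = s at hyz
      cases hyz with
      | exc y x hyx =>
        cases hs
        exact Or.inl ⟨j + 1, by rw [G.exc_disjoint _ _ _ hyx (c.chain j)]⟩
      | chain c' i' =>
        obtain ⟨-, rfl⟩ := G.arrowNode_eq (NodeData.WNode.plain.inj hs)
        exact Or.inr .refl
      | excArrow c' x hx => cases hs
    · exact Or.inr (hy.tail hyz)

/-- The wnodes that embrace a given wnode are linearly ordered. -/
theorem embraces_total {a b c : G.WNode} (hb : G.Embraces b a) (hc : G.Embraces c a) :
    G.Embraces b c ∨ G.Embraces c b := by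
  unfold PreWGraph.Embraces at hb
  -- Climbing from `a`, the next wnode is unique, except that a term of an `ω⃗`-wnode leads both to
  -- the next term and to the `ω⃗`-wnode, which embraces all terms.
  induction hb using Relation.ReflTransGen.head_induction_on with
  | refl => exact Or.inr hc
  | @head a a' h h' ih =>
    obtain rfl | ⟨a'', h2, h2'⟩ := Relation.ReflTransGen.cases_head hc
    · exact Or.inl (h'.head h)
    cases h with
    | exc y x hyx =>
      generalize hs : NodeData.WNode.plain y = s at h2
      cases h2 with
      | exc y' x' hyx' =>
        cases hs
        cases G.exc_disjoint _ _ _ hyx hyx'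
        exact ih h2'
      | chain e i =>
        cases hs
        cases G.exc_disjoint _ _ _ hyx (e.chain i)
        exact ih (h2'.head (.chain e (i + 1)))
      | excArrow => cases hs
    | chain e i =>
      obtain ⟨j, rfl⟩ | hce := G.embraces_seq hc
      · exact Or.inl (h'.head (.chain e j))
      · exact ih hce
    | excArrow e x hx =>
      cases h2 with
      | excArrow _ x' hx' =>
        cases G.excArrow_disjoint _ _ _ hx hx'
        exact ih h2'

theorem shorted_refl (x : G.WNode) : G.Shorted x x := ⟨x, .refl, .refl⟩

variable {G}

theorem shorted_symm {x y : G.WNode} (h : G.Shorted x y) : G.Shorted y x :=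
  h.imp fun _ hz => hz.symm

/-- The two wnodes embracing `y` are comparable, and the larger one embraces both `x` and `z`. -/
theorem shorted_trans {x y z : G.WNode} (h : G.Shorted x y) (h' : G.Shorted y z) :
    G.Shorted x z := by
  obtain ⟨a, hax, hay⟩ := h
  obtain ⟨b, hby, hbz⟩ := h'
  obtain hab | hba := G.embraces_total hay hby
  · exact ⟨a, hax, hbz.trans hab⟩
  · exact ⟨b, hax.trans hba, hbz⟩

/-! ## Two-ended walks -/

theorem valid_tip (d d' : Bool) {W : ℕ → Piece (G.Node 0)} (h : G.Valid (.tip d W)) :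
    G.Valid (.tip d' W) := by
  simp only [PreWGraph.Valid] at h ⊢
  exact ⟨h.1, h.2.1, fun n => Piece.level_tip d d' W ▸ h.2.2 n⟩

theorem valid_reverse {p : Piece (G.Node 0)} (h : G.Valid p) : G.Valid p.reverse := by
  cases p with
  | branch v w =>
    simp only [Piece.reverse, PreWGraph.Valid] at h ⊢
    exact h.symm
  | tip d W => exact valid_tip _ _ h

theorem endsAt_reverse {p : Piece (G.Node 0)} {e : Bool} {x : G.WNode} (h : G.EndsAt p e x) :
    G.EndsAt p.reverse (!e) x := by
  cases p with
  | branch v w => cases e <;> simpa [Piece.reverse, PreWGraph.EndsAt] using h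
  | tip d W => cases e <;> cases d <;> simpa [Piece.reverse, PreWGraph.EndsAt] using h

theorem isWalk_of_shorted {ρ : ℕ∞} {x x' y : G.WNode} {l : List (Piece (G.Node 0))}
    (h : G.Shorted x' x) (hl : G.IsWalk ρ x y l) : G.IsWalk ρ x' y l := by
  cases l with
  | nil => exact shorted_trans h hl
  | cons p l =>
    obtain ⟨hp, hρ, a, b, ha, hb, hxa, hl⟩ := hl
    exact ⟨hp, hρ, a, b, ha, hb, shorted_trans h hxa, hl⟩

theorem isWalk_append {ρ : ℕ∞} {x y z : G.WNode} {l l' : List (Piece (G.Node 0))}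
    (h : G.IsWalk ρ x y l) (h' : G.IsWalk ρ y z l') : G.IsWalk ρ x z (l ++ l') := by
  induction l generalizing x with
  | nil => exact isWalk_of_shorted h h'
  | cons p l ih =>
    obtain ⟨hp, hρ, a, b, ha, hb, hxa, hl⟩ := h
    exact ⟨hp, hρ, a, b, ha, hb, hxa, ih hl⟩

theorem isWalk_reverse {ρ : ℕ∞} {x y : G.WNode} {l : List (Piece (G.Node 0))}
    (h : G.IsWalk ρ x y l) : ∃ l', G.IsWalk ρ y x l' ∧ walkLength l' = walkLength l := by
  induction l generalizing x with
  | nil => exact ⟨[], shorted_symm h, rfl⟩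
  | cons p l ih =>
    obtain ⟨hp, hρ, a, b, ha, hb, hxa, hl⟩ := h
    obtain ⟨l', hl', hlen⟩ := ih hl
    have hwalk : G.IsWalk ρ b x [p.reverse] :=
      ⟨valid_reverse hp, by rwa [Piece.level_reverse], b, a, endsAt_reverse hb,
        endsAt_reverse ha, G.shorted_refl b, shorted_symm hxa⟩
    refine ⟨l' ++ [p.reverse], isWalk_append hl' hwalk, ?_⟩
    rw [walkLength_append, walkLength_cons, walkLength_cons, walkLength_nil, natSum_zero,
      Piece.level_reverse, hlen, natSum_comm]

theorem isWalk_mono {ρ σ : ℕ∞} (hρσ : ρ ≤ σ) {x y : G.WNode} {l : List (Piece (G.Node 0))}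
    (h : G.IsWalk ρ x y l) : G.IsWalk σ x y l := by
  induction l generalizing x with
  | nil => exact h
  | cons p l ih =>
    obtain ⟨hp, hρ, a, b, ha, hb, hxa, hl⟩ := h
    exact ⟨hp, hρ.trans hρσ, a, b, ha, hb, hxa, ih hl⟩

theorem level_le_of_isWalk {ρ : ℕ∞} {x y : G.WNode} {l : List (Piece (G.Node 0))}
    (h : G.IsWalk ρ x y l) : ∀ p ∈ l, p.level ≤ ρ := by
  induction l generalizing x with
  | nil => simp
  | cons p l ih =>
    obtain ⟨_, hρ, a, b, _, _, _, hl⟩ := h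
    exact List.forall_mem_cons.2 ⟨hρ, ih hl⟩

/-- The wnode where a piece ends or starts has at most the level of the piece as its rank. -/
theorem exists_of_endsAt {p : Piece (G.Node 0)} (hp : G.Valid p) {e : Bool} {x : G.WNode}
    (h : G.EndsAt p e x) : ∃ (k : ℕ∞) (y : G.Node k), k ≤ p.level ∧ x = .plain ⟨k, y⟩ := by
  induction p generalizing e x with
  | branch v w => exact ⟨0, _, zero_le, h⟩
  | tip d W ih =>
    simp only [PreWGraph.EndsAt] at h
    obtain ⟨-, k, y, hy, rfl⟩ | ⟨-, h⟩ := h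
    · refine ⟨k, y, ?_, rfl⟩
      rw [← (G.tip_isOneEnded k W y hy).2, Piece.level_tip]
    · have hp' := hp
      simp only [PreWGraph.Valid] at hp'
      obtain ⟨k, y, hk, rfl⟩ := ih 0 (hp'.1 0) h
      exact ⟨k, y, hk.trans (hp'.2.2 0).le, rfl⟩

theorem ofIdx_mono : Monotone Rank.ofIdx := by
  intro a b hab
  induction b using ENat.recTopCoe with
  | top => exact le_top
  | coe n =>
    induction a using ENat.recTopCoe with
    | top => exact absurd hab (by simp)
    | coe m => exact WithTop.coe_le_coe.2 hab

/-- An outward piece starts where its first piece does. An inward piece starts at its wtip, which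
lies in some wnode because its level is a rank of `G`. -/
theorem exists_endsAt_start {p : Piece (G.Node 0)} (hp : G.Valid p)
    (hν : Rank.ofIdx p.level ≤ ν) : ∃ x, G.EndsAt p false x := by
  induction p with
  | branch v w => exact ⟨_, rfl⟩
  | tip d W ih =>
    cases d with
    | true =>
      have hp' := hp
      simp only [PreWGraph.Valid] at hp'
      obtain ⟨x, hx⟩ := ih 0 (hp'.1 0) ((ofIdx_mono (hp'.2.2 0).le).trans hν)
      exact ⟨x, by simpa [PreWGraph.EndsAt] using hx⟩
    | false =>
      obtain ⟨y, hy, -⟩ := G.tip_existsUnique _ W hν ⟨valid_tip _ _ hp, Piece.level_tip _ _ W⟩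
      exact ⟨.plain ⟨_, y⟩, by simpa [PreWGraph.EndsAt] using ⟨_, y, hy, rfl, HEq.rfl⟩⟩

/-- From every wnode whose rank is `k` there is a walk to a `0`-node of length at most
`ω ^ k * 2`. -/
theorem exists_isWalk_zero (k : ℕ∞) (y : G.Node k) :
    ∃ (x : G.Node 0) (l : List (Piece (G.Node 0))),
      G.IsWalk k (.plain ⟨k, y⟩) (.plain ⟨0, x⟩) l ∧
      walkLength l ≤ ω ^ idxOrd k * ((2 : ℕ) : Ordinal.{0}) := by
  induction k using WellFoundedLT.induction with
  | ind k ih =>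
    obtain rfl | hk := eq_or_ne k 0
    · exact ⟨y, [], G.shorted_refl _, by simp [walkLength_nil]⟩
    -- Leave `y` through one of its wtips and come inwards to the starting wnode of `W`, which has
    -- rank below `k`.
    obtain ⟨W, hW⟩ := G.exists_tip k y hk
    obtain ⟨hval, hlev⟩ := G.tip_isOneEnded k W y hW
    have hν : Rank.ofIdx k ≤ ν := (G.nonempty_iff k).1 ⟨y⟩
    have hval' := hval
    simp only [PreWGraph.Valid] at hval'
    have hlt : (W 0).level < k := hlev ▸ hval'.2.2 0
    obtain ⟨z, hz⟩ := exists_endsAt_start (hval'.1 0) ((ofIdx_mono hlt.le).trans hν)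
    obtain ⟨j, z, hj, rfl⟩ := exists_of_endsAt (hval'.1 0) hz
    have hjk := hj.trans_lt hlt
    obtain ⟨x, l, hl, hlen⟩ := ih j hjk z
    have hlev' : (Piece.tip false W).level = k := (Piece.level_tip _ _ W).trans hlev
    refine ⟨x, .tip false W :: l, ⟨valid_tip _ _ hval, hlev'.le, .plain ⟨k, y⟩, .plain ⟨j, z⟩,
      ?_, ?_, G.shorted_refl _, isWalk_mono hjk.le hl⟩, ?_⟩
    · simpa [PreWGraph.EndsAt] using ⟨k, y, hW, rfl, HEq.rfl⟩
    · simpa [PreWGraph.EndsAt] using hz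
    · rw [walkLength_cons, hlev']
      refine natSum_le_opow_mul (a := 1) (a' := 1) (by simp) (hlen.trans ?_)
      -- The rest of the walk, being of lower order, fits into one unit `ω ^ k`; so the factor 2
      -- does not grow with the induction.
      calc (ω : Ordinal.{0}) ^ idxOrd j * ((2 : ℕ) : Ordinal.{0})
          ≤ ω ^ idxOrd j * ω := by gcongr; exact (natCast_lt_omega0 2).le
        _ = ω ^ (idxOrd j + 1) := by rw [opow_add, opow_one]
        _ ≤ ω ^ idxOrd k :=
          opow_le_opow_right omega0_pos (Order.add_one_le_of_lt (idxOrd_strictMono hjk))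
        _ = _ := by simp

/-! ## The wdistance -/

theorem wdist_le {x y : G.WNode} {l : List (Piece (G.Node 0))} {ρ : ℕ∞} (h : G.IsWalk ρ x y l) :
    G.wdist x y ≤ walkLength l :=
  csInf_le' ⟨l, isWalk_mono le_top h, rfl⟩

theorem exists_isWalk_eq_wdist (x y : G.WNode) :
    ∃ l, G.IsWalk ⊤ x y l ∧ G.wdist x y = walkLength l := by
  have hne : {o | ∃ l, G.IsWalk ⊤ x y l ∧ o = walkLength l}.Nonempty :=
    let ⟨l, hl⟩ := G.wconnected x y
    ⟨_, l, hl, rfl⟩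
  exact csInf_mem hne

theorem wdist_symm (x y : G.WNode) : G.wdist x y = G.wdist y x := by
  have key : ∀ x y : G.WNode, G.wdist x y ≤ G.wdist y x := fun x y => by
    obtain ⟨l, hl, h⟩ := exists_isWalk_eq_wdist y x
    obtain ⟨l', hl', h'⟩ := isWalk_reverse hl
    rw [h, ← h']
    exact wdist_le hl'
  exact (key x y).antisymm (key y x)

theorem wdist_triangle_le {e : Ordinal.{0}} {x y z : G.WNode} {a b : ℕ}
    (h : G.wdist x y ≤ ω ^ e * a) (h' : G.wdist y z ≤ ω ^ e * b) :
    G.wdist x z ≤ ω ^ e * ((a + b : ℕ) : Ordinal.{0}) := by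
  obtain ⟨l, hl, hd⟩ := exists_isWalk_eq_wdist x y
  obtain ⟨l', hl', hd'⟩ := exists_isWalk_eq_wdist y z
  calc G.wdist x z ≤ walkLength (l ++ l') := wdist_le (isWalk_append hl hl')
    _ = natSum (G.wdist x y) (G.wdist y z) := by rw [walkLength_append, hd, hd']
    _ ≤ _ := natSum_le_opow_mul h h'

/-! ## Wsections -/

section WSection

variable {ρ : ℕ∞} {S : Set G.WNode}

/-- Adjoining `y` to `S` preserves wconnectedness, by routing walks through `x`; maximality then
puts `y` in `S`. -/
theorem mem_of_isWalk (hS : G.IsWSection ρ S) {x y : G.WNode} (hx : x ∈ S)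
    (hy : y.rank ≤ Rank.ofIdx ρ) {l : List (Piece (G.Node 0))} (h : G.IsWalk ρ x y l) : y ∈ S := by
  obtain ⟨-, ⟨hrank, hconn⟩, hmax⟩ := hS
  refine hmax ⟨?_, ?_⟩ (Set.subset_insert y S) (Set.mem_insert y S)
  · rintro z (rfl | hz)
    exacts [hy, hrank z hz]
  have hto : ∀ z ∈ insert y S, ∃ l, G.IsWalk ρ x z l := by
    rintro z (rfl | hz)
    exacts [⟨l, h⟩, hconn x hx z hz]
  intro z hz w hw
  obtain ⟨l₁, h₁⟩ := hto z hz
  obtain ⟨l₂, h₂⟩ := hto w hw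
  obtain ⟨l₁', h₁', -⟩ := isWalk_reverse h₁
  exact ⟨_, isWalk_append h₁' h₂⟩

theorem exists_wdist_le (hS : G.IsWSection ρ S) {x y : G.WNode} (hx : x ∈ S) (hy : y ∈ S) :
    ∃ m : ℕ, G.wdist x y ≤ ω ^ idxOrd ρ * m := by
  obtain ⟨l, hl⟩ := hS.2.1.2 x hx y hy
  exact ⟨_, (wdist_le hl).trans (walkLength_le (level_le_of_isWalk hl))⟩

/-! ### The distance in units of `ω ^ ρ` -/

/-- The least natural number `m` such that the wdistance is at most `ω ^ ρ * m`. -/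
noncomputable def scaledDist (G : WGraph.{u} ν) (ρ : ℕ∞) (x y : G.WNode) : ℕ :=
  sInf {m : ℕ | G.wdist x y ≤ ω ^ idxOrd ρ * (m : Ordinal.{0})}

/-- For wnodes of `S` the defining set is nonempty, so the infimum is attained and is not the
default value 0. -/
theorem scaledDist_le_iff (hS : G.IsWSection ρ S) {x y : G.WNode} (hx : x ∈ S) (hy : y ∈ S)
    {m : ℕ} : G.scaledDist ρ x y ≤ m ↔ G.wdist x y ≤ ω ^ idxOrd ρ * (m : Ordinal.{0}) := by
  refine ⟨fun h => ?_, fun h => Nat.sInf_le h⟩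
  have hmem : G.scaledDist ρ x y ∈ {m : ℕ | G.wdist x y ≤ ω ^ idxOrd ρ * (m : Ordinal.{0})} :=
    Nat.sInf_mem (exists_wdist_le hS hx hy)
  exact hmem.trans (opow_mul_natCast_le_iff.2 h)

theorem scaledDist_comm (x y : G.WNode) : G.scaledDist ρ x y = G.scaledDist ρ y x := by
  unfold scaledDist
  rw [wdist_symm]

theorem scaledDist_triangle (hS : G.IsWSection ρ S) {x y z : G.WNode} (hx : x ∈ S) (hy : y ∈ S)
    (hz : z ∈ S) : G.scaledDist ρ x z ≤ G.scaledDist ρ x y + G.scaledDist ρ y z := by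
  rw [scaledDist_le_iff hS hx hz]
  exact wdist_triangle_le ((scaledDist_le_iff hS hx hy).1 le_rfl)
    ((scaledDist_le_iff hS hy hz).1 le_rfl)

theorem scaledDist_self (hS : G.IsWSection ρ S) {x : G.WNode} (hx : x ∈ S) :
    G.scaledDist ρ x x = 0 := by
  rw [← Nat.le_zero, scaledDist_le_iff hS hx hx]
  exact (wdist_le (l := []) (ρ := ρ) (G.shorted_refl x)).trans (by simp [walkLength_nil])

theorem rank_le_of_endsAt {p : Piece (G.Node 0)} (hp : G.Valid p) (hρ : p.level ≤ ρ) {e : Bool}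
    {x : G.WNode} (h : G.EndsAt p e x) : x.rank ≤ Rank.ofIdx ρ := by
  obtain ⟨k, y, hk, rfl⟩ := exists_of_endsAt hp h
  exact ofIdx_mono (hk.trans hρ)

/-- Along a walk of rank at most `ρ` the distance from a fixed wnode takes all intermediate
values. -/
theorem exists_scaledDist_eq_of_isWalk (hS : G.IsWSection ρ S) {o : G.WNode} (ho : o ∈ S) {t : ℕ}
    {x y : G.WNode} (hx : x ∈ S) (hy : y ∈ S) {l : List (Piece (G.Node 0))}
    (hl : G.IsWalk ρ x y l) (hxt : G.scaledDist ρ o x ≤ t) (hyt : t ≤ G.scaledDist ρ o y) :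
    ∃ z ∈ S, G.scaledDist ρ o z = t := by
  induction l generalizing x with
  | nil =>
    have h0 : G.scaledDist ρ x y ≤ 0 := by
      rw [scaledDist_le_iff hS hx hy]
      exact (wdist_le hl).trans (by simp [walkLength_nil])
    have := scaledDist_triangle hS ho hx hy
    exact ⟨x, hx, by omega⟩
  | cons p l ih =>
    obtain ⟨hp, hρ, a, b, ha, hb, hxa, hl⟩ := hl
    have hwalk : G.IsWalk ρ x b [p] := ⟨hp, hρ, a, b, ha, hb, hxa, G.shorted_refl b⟩
    have hbS : b ∈ S := mem_of_isWalk hS hx (rank_le_of_endsAt hp hρ hb) hwalk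
    have h1 : G.scaledDist ρ x b ≤ 1 := by
      rw [scaledDist_le_iff hS hx hbS]
      exact (wdist_le hwalk).trans (walkLength_le (level_le_of_isWalk hwalk))
    have := scaledDist_triangle hS ho hx hbS
    by_cases hbt : G.scaledDist ρ o b ≤ t
    · exact ih hbS hl hbt
    -- The distance exceeds `t` at `b` and is at most `t` at `x`; as it grows by at most 1, it
    -- equals `t` at `x`.
    · exact ⟨x, hx, by omega⟩

/-- Allowing `z` to be merely shorted to `y` covers an `ω⃗`-wnode, which is shorted to its terms. -/
theorem exists_zero_node_near_plain (hS : G.IsWSection ρ S) {k : ℕ∞} {y : G.Node k} (hk : k ≤ ρ)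
    {z : G.WNode} (hz : z ∈ S) (hyz : G.Shorted z (.plain ⟨k, y⟩)) :
    ∃ x ∈ S, x.rank = 0 ∧ G.scaledDist ρ z x ≤ 2 := by
  obtain ⟨x, l, hl, hlen⟩ := exists_isWalk_zero k y
  have hl' : G.IsWalk ρ z (.plain ⟨0, x⟩) l := isWalk_mono hk (isWalk_of_shorted hyz hl)
  have h0 : (NodeData.WNode.plain ⟨0, x⟩ : G.WNode).rank = 0 := rfl
  have hxS : .plain ⟨0, x⟩ ∈ S := mem_of_isWalk hS hz (by rw [h0]; exact zero_le) hl'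
  refine ⟨_, hxS, h0, ?_⟩
  rw [scaledDist_le_iff hS hz hxS]
  refine (wdist_le hl').trans (hlen.trans ?_)
  gcongr
  exacts [omega0_pos, idxOrd_strictMono.monotone hk]

theorem le_of_ofIdx_le {a b : ℕ∞} (h : Rank.ofIdx a ≤ Rank.ofIdx b) : a ≤ b := by
  induction b using ENat.recTopCoe with
  | top => exact le_top
  | coe n =>
    induction a using ENat.recTopCoe with
    | top => exact absurd h (by simp [Rank.ofIdx])
    | coe m => exact WithTop.coe_le_coe.1 h

theorem exists_zero_node_near (hS : G.IsWSection ρ S) {z : G.WNode} (hz : z ∈ S) :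
    ∃ x ∈ S, x.rank = 0 ∧ G.scaledDist ρ z x ≤ 2 := by
  have hrank := hS.2.1.1 z hz
  cases z with
  | plain y => exact exists_zero_node_near_plain hS (le_of_ofIdx_le hrank) hz (G.shorted_refl _)
  | arrow c =>
    refine exists_zero_node_near_plain (k := (c.seq 0).1) (y := (c.seq 0).2) hS ?_ hz
      ⟨.arrow c, .refl, .single (.chain c 0)⟩
    -- A wsection that contains an `ω⃗`-wnode has `ρ = ω`.
    induction ρ using ENat.recTopCoe with
    | top => exact le_top
    | coe n => exact absurd (WithTop.coe_le_coe.1 hrank) (by simp)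

end WSection

end WGraph

namespace WGraph

/-! ## Hypernodes and galaxies -/

section Galaxies

variable {ν : Rank} {G : WGraph.{u} ν} {F : Ultrafilter ℕ} {ρ : ℕ∞} {S : Set G.WNode}

/-- A sequence of wnodes that represents a hypernode. -/
noncomputable def rep (x : HyperNode F S) (n : ℕ) : G.WNode := (Quotient.out x.2 n).1

theorem rep_mem (x : HyperNode F S) (n : ℕ) : rep x n ∈ S := (Quotient.out x.2 n).2.1

theorem hyperDist_eq (x y : HyperNode F S) :
    hyperDist x y = ((fun n => G.wdist (rep x n) (rep y n) : ℕ → Ordinal.{0}) :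
      (F : Filter ℕ).Germ Ordinal.{0}) := by
  obtain ⟨a, x⟩ := x
  obtain ⟨b, y⟩ := y
  unfold hyperDist rep
  conv_lhs => rw [← Quotient.out_eq x, ← Quotient.out_eq y]
  rfl

/-- The hypernode of a sequence of `0`-nodes. -/
def zeroHyperNode (F : Ultrafilter ℕ) (f : ℕ → G.WNode) (hf : ∀ n, f n ∈ S ∧ (f n).rank = 0) :
    HyperNode F S :=
  ⟨0, ((fun n => ⟨f n, hf n⟩ : ℕ → {x : G.WNode // x ∈ S ∧ x.rank = 0}) :
    (F : Filter ℕ).Germ {x : G.WNode // x ∈ S ∧ x.rank = 0})⟩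

/-- The chosen representative of a class agrees with the given sequence only modulo `F`. -/
theorem rep_zeroHyperNode (f : ℕ → G.WNode) (hf : ∀ n, f n ∈ S ∧ (f n).rank = 0) :
    ∀ᶠ n in (F : Filter ℕ), rep (zeroHyperNode F f hf) n = f n := by
  have h : (F : Filter ℕ).EventuallyEq
      (Quotient.out (zeroHyperNode F f hf).2) (fun n => ⟨f n, hf n⟩) :=
    Germ.coe_eq.1 (Quotient.out_eq (zeroHyperNode F f hf).2)
  filter_upwards [h] with n hn
  exact congrArg Subtype.val hn

theorem limitedlyDistant_iff (hS : G.IsWSection ρ S) {x y : HyperNode F S} :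
    LimitedlyDistant ρ x y ↔
      ∃ m : ℕ, ∀ᶠ n in (F : Filter ℕ), G.scaledDist ρ (rep x n) (rep y n) ≤ m := by
  unfold LimitedlyDistant
  simp only [hyperDist_eq, scaledDist_le_iff hS (rep_mem _ _) (rep_mem _ _)]
  exact Iff.rfl

theorem limitedlyDistant_trans (hS : G.IsWSection ρ S) {x y z : HyperNode F S}
    (h : LimitedlyDistant ρ x y) (h' : LimitedlyDistant ρ y z) : LimitedlyDistant ρ x z := by
  rw [limitedlyDistant_iff hS] at h h' ⊢
  obtain ⟨a, ha⟩ := h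
  obtain ⟨b, hb⟩ := h'
  refine ⟨a + b, ?_⟩
  filter_upwards [ha, hb] with n hn hn'
  have := scaledDist_triangle hS (rep_mem x n) (rep_mem y n) (rep_mem z n)
  omega

theorem limitedlyDistant_refl (hS : G.IsWSection ρ S) (x : HyperNode F S) :
    LimitedlyDistant ρ x x :=
  (limitedlyDistant_iff hS).2
    ⟨0, Eventually.of_forall fun n => (scaledDist_self hS (rep_mem x n)).le⟩

/-- The galaxy of a hypernode. -/
def galaxyOf (ρ : ℕ∞) (x : HyperNode F S) : HyperSubgraph F S :=
  inducedBy {y | LimitedlyDistant ρ x y}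

theorem mem_galaxyOf_self (hS : G.IsWSection ρ S) (x : HyperNode F S) :
    x ∈ (galaxyOf ρ x).nodes := limitedlyDistant_refl hS x

/-- Every wnode of `S` is at finite scaled distance from `o`, so one base point replaces all
standard hypernodes. -/
theorem mem_principalGalaxy_iff (hS : G.IsWSection ρ S) {o : G.WNode} (ho : o ∈ S)
    (ho0 : o.rank = 0) {y : HyperNode F S} :
    y ∈ (principalGalaxy F S ρ).nodes ↔
      ∃ m : ℕ, ∀ᶠ n in (F : Filter ℕ), G.scaledDist ρ o (rep y n) ≤ m := by
  constructor
  · rintro ⟨⟨α, x⟩, ⟨s, hs⟩, hxy⟩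
    change {x : G.WNode // x ∈ S ∧ x.rank = α} at s
    obtain rfl : x = Germ.const s := hs
    obtain ⟨m, hm⟩ := (limitedlyDistant_iff hS).1 hxy
    have hrep : ∀ᶠ n in (F : Filter ℕ), rep (⟨α, Germ.const s⟩ : HyperNode F S) n = s.1 := by
      have h : (F : Filter ℕ).EventuallyEq
          (Quotient.out (Germ.const s : HyperNodeOf F S α)) (fun _ => s) :=
        Germ.coe_eq.1 (Quotient.out_eq (Germ.const s : HyperNodeOf F S α))
      filter_upwards [h] with n hn
      exact congrArg Subtype.val hn
    refine ⟨G.scaledDist ρ o s.1 + m, ?_⟩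
    filter_upwards [hm, hrep] with n hn hn'
    rw [hn'] at hn
    have := scaledDist_triangle hS ho s.2.1 (rep_mem y n)
    omega
  · rintro ⟨m, hm⟩
    refine ⟨zeroHyperNode F (fun _ => o) (fun _ => ⟨ho, ho0⟩), ⟨⟨o, ho, ho0⟩, rfl⟩,
      (limitedlyDistant_iff hS).2 ⟨m, ?_⟩⟩
    filter_upwards [hm, rep_zeroHyperNode (fun _ => o) (fun _ => ⟨ho, ho0⟩)] with n hn hn'
    rwa [hn']

theorem galaxyOf_eq_principalGalaxy (hS : G.IsWSection ρ S) {x : HyperNode F S}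
    (hx : x ∈ (principalGalaxy F S ρ).nodes) : galaxyOf ρ x = principalGalaxy F S ρ := by
  obtain ⟨o, ho, ho0, -⟩ := exists_zero_node_near hS hS.1.some_mem
  unfold galaxyOf principalGalaxy
  congr 1
  ext y
  obtain ⟨s, hs, hsx⟩ := hx
  refine ⟨fun h => ⟨s, hs, limitedlyDistant_trans hS hsx h⟩, fun hy => ?_⟩
  obtain ⟨a, ha⟩ := (mem_principalGalaxy_iff hS ho ho0).1 ⟨s, hs, hsx⟩
  obtain ⟨b, hb⟩ := (mem_principalGalaxy_iff hS ho ho0).1 hy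
  refine (limitedlyDistant_iff hS).2 ⟨a + b, ?_⟩
  filter_upwards [ha, hb] with n hn hn'
  have := scaledDist_triangle hS (rep_mem x n) ho (rep_mem y n)
  rw [scaledDist_comm] at hn
  omega

theorem isGalaxy_principalGalaxy (hS : G.IsWSection ρ S) :
    IsGalaxy ρ (principalGalaxy F S ρ) := by
  obtain ⟨o, ho, ho0, -⟩ := exists_zero_node_near hS hS.1.some_mem
  refine ⟨zeroHyperNode F (fun _ => o) (fun _ => ⟨ho, ho0⟩),
    (galaxyOf_eq_principalGalaxy hS ?_).symm⟩
  exact ⟨_, ⟨⟨o, ho, ho0⟩, rfl⟩, limitedlyDistant_refl hS _⟩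

/-! ### Being closer, in terms of scaled distances -/

theorem scaledDist_add_le_of_natSum_le (hS : G.IsWSection ρ S) {a b c : G.WNode} (ha : a ∈ S)
    (hb : b ∈ S) (hc : c ∈ S) {m : ℕ}
    (h : natSum (G.wdist a c) (ω ^ idxOrd ρ * (m : Ordinal.{0})) ≤ G.wdist b c) :
    G.scaledDist ρ a c + m ≤ G.scaledDist ρ b c + 1 := by
  have hac := (scaledDist_le_iff hS ha hc).1 le_rfl
  have hbc := (scaledDist_le_iff hS hb hc).1 le_rfl
  -- Rounding up loses at most one unit, the source of the `+ 1` in the conclusion; at distance 0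
  -- the truncated subtraction makes the bound trivial.
  have hlow : ω ^ idxOrd ρ * ((G.scaledDist ρ a c - 1 : ℕ) : Ordinal.{0}) ≤ G.wdist a c := by
    obtain h0 | h0 := Nat.eq_zero_or_pos (G.scaledDist ρ a c)
    · simp [h0]
    · by_contra! hlt
      have := (scaledDist_le_iff hS ha hc).2 hlt.le
      omega
  have := opow_mul_natCast_le_iff.1 ((opow_mul_le_natSum hac hlow m).trans (h.trans hbc))
  omega

theorem natSum_le_of_scaledDist_add_lt (hS : G.IsWSection ρ S) {a b c : G.WNode} (ha : a ∈ S)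
    (hb : b ∈ S) (hc : c ∈ S) {m : ℕ} (h : G.scaledDist ρ a c + m < G.scaledDist ρ b c) :
    natSum (G.wdist a c) (ω ^ idxOrd ρ * (m : Ordinal.{0})) ≤ G.wdist b c := by
  refine (natSum_le_opow_mul ((scaledDist_le_iff hS ha hc).1 le_rfl) le_rfl).trans ?_
  by_contra! hlt
  exact h.not_ge ((scaledDist_le_iff hS hb hc).2 hlt.le)

theorem zero_ne_arrow : (0 : Rank) ≠ Rank.arrow :=
  fun h => absurd (WithTop.coe_injective h) (by simp)

/-- For galaxies of `0`-hypernodes, being closer means that the difference of the scaled distances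
from a fixed `0`-node is unlimited. -/
theorem closer_galaxyOf_iff (hS : G.IsWSection ρ S) {o : G.WNode} (ho : o ∈ S) (ho0 : o.rank = 0)
    {y z : HyperNode F S} (hy : y ∉ (principalGalaxy F S ρ).nodes)
    (hz : z ∉ (principalGalaxy F S ρ).nodes) (hy0 : y.1 = 0) (hz0 : z.1 = 0) :
    Closer ρ (galaxyOf ρ y) (galaxyOf ρ z) ↔
      ∀ m : ℕ, ∀ᶠ n in (F : Filter ℕ),
        G.scaledDist ρ o (rep y n) + m ≤ G.scaledDist ρ o (rep z n) := by
  constructor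
  · rintro ⟨-, -, -, -, x, hx, y', hy', z', hz', -, -, -, h⟩ m
    obtain ⟨p, hp⟩ := (mem_principalGalaxy_iff hS ho ho0).1 hx
    obtain ⟨q, hq⟩ := (limitedlyDistant_iff hS).1 hy'
    obtain ⟨r, hr⟩ := (limitedlyDistant_iff hS).1 hz'
    -- Passing from `x` to `o` costs `p` in each of the two distances, from `y'` to `y` costs `q`,
    -- from `z'` to `z` costs `r`, and rounding costs 1.
    have hM := h (m + (2 * p + q + r + 1))
    rw [hyperDist_eq, hyperDist_eq] at hM
    have hM' : ∀ᶠ n in (F : Filter ℕ), _ ≤ _ := Germ.coe_le.1 hM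
    filter_upwards [hp, hq, hr, hM'] with n hp hq hr hM
    have h0 := scaledDist_add_le_of_natSum_le hS (rep_mem y' n) (rep_mem z' n) (rep_mem x n) hM
    have h1 := scaledDist_triangle hS ho (rep_mem x n) (rep_mem y n)
    have h2 := scaledDist_triangle hS (rep_mem x n) (rep_mem y' n) (rep_mem y n)
    have h3 := scaledDist_triangle hS (rep_mem z' n) ho (rep_mem x n)
    have h4 := scaledDist_triangle hS ho (rep_mem z n) (rep_mem z' n)
    rw [scaledDist_comm (rep x n) (rep y' n), scaledDist_comm (rep y' n) (rep y n)] at h2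
    rw [scaledDist_comm (rep z' n) o] at h3
    omega
  · intro h
    have hne : ∀ {w : HyperNode F S}, w ∉ (principalGalaxy F S ρ).nodes →
        galaxyOf ρ w ≠ principalGalaxy F S ρ :=
      fun hw heq => hw (heq ▸ mem_galaxyOf_self hS _)
    refine ⟨⟨y, rfl⟩, ⟨z, rfl⟩, hne hy, hne hz,
      zeroHyperNode F (fun _ => o) (fun _ => ⟨ho, ho0⟩),
      ⟨_, ⟨⟨o, ho, ho0⟩, rfl⟩, limitedlyDistant_refl hS _⟩, y, mem_galaxyOf_self hS y,
      z, mem_galaxyOf_self hS z, zero_ne_arrow, hy0 ▸ zero_ne_arrow, hz0 ▸ zero_ne_arrow,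
      fun m => ?_⟩
    rw [hyperDist_eq, hyperDist_eq]
    refine Germ.coe_le.2 ?_
    -- The extra 1 gives the strict inequality that undoes the rounding.
    filter_upwards [h (m + 1), rep_zeroHyperNode (F := F) (fun _ => o) (fun _ => ⟨ho, ho0⟩)]
      with n hn hn'
    refine natSum_le_of_scaledDist_add_lt hS (rep_mem y n) (rep_mem z n) (rep_mem _ n) ?_
    rw [hn', scaledDist_comm _ o, scaledDist_comm _ o]
    omega

/-! ### The chain of galaxies -/

/-- A wsection with wnodes at arbitrarily large distances from `o` has `0`-nodes at approximately
every distance from `o`. -/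
theorem exists_zero_node_scaledDist (hS : G.IsWSection ρ S) {o : G.WNode} (ho : o ∈ S)
    {t : ℕ} (hfar : ∃ y ∈ S, t ≤ G.scaledDist ρ o y) :
    ∃ w ∈ S, w.rank = 0 ∧ G.scaledDist ρ o w ≤ t + 2 ∧ t ≤ G.scaledDist ρ o w + 2 := by
  obtain ⟨y, hy, hty⟩ := hfar
  obtain ⟨l, hl⟩ := hS.2.1.2 o ho y hy
  obtain ⟨z, hz, rfl⟩ := exists_scaledDist_eq_of_isWalk hS ho ho hy hl
    ((scaledDist_self hS ho).trans_le (Nat.zero_le t)) hty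
  obtain ⟨w, hw, hw0, hzw⟩ := exists_zero_node_near hS hz
  have h1 := scaledDist_triangle hS ho hz hw
  have h2 := scaledDist_triangle hS ho hw hz
  rw [scaledDist_comm w z] at h2
  exact ⟨w, hw, hw0, by omega, by omega⟩

theorem exists_int_chain_of_notMem_principalGalaxy (hS : G.IsWSection ρ S) {v : HyperNode F S}
    (hv : v ∉ (principalGalaxy F S ρ).nodes) :
    ∃ Γ : ℤ → HyperSubgraph F S,
      (∀ i, IsGalaxy ρ (Γ i) ∧ Γ i ≠ principalGalaxy F S ρ) ∧
      Function.Injective Γ ∧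
      (∀ i j, Closer ρ (Γ i) (Γ j) ↔ i < j) ∧
      ∃ i, v ∈ (Γ i).nodes := by
  obtain ⟨o, ho, ho0, -⟩ := exists_zero_node_near hS hS.1.some_mem
  set K : ℕ → ℕ := fun n => G.scaledDist ρ o (rep v n) with hKdef
  have hK : ∀ m : ℕ, ∀ᶠ n in (F : Filter ℕ), m ≤ K n := by
    intro m
    -- For an ultrafilter, failing to be almost always at least `m` means being almost always below
    -- `m`, which would put `v` in the principal galaxy.
    by_contra hm
    refine hv ((mem_principalGalaxy_iff hS ho ho0).2 ⟨m, ?_⟩)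
    filter_upwards [Ultrafilter.eventually_not.2 hm] with n hn
    exact (not_le.1 hn).le
  -- the target distances of the galaxy with index `i`
  set g : ℤ → ℕ → ℕ := fun i n => ⌊(K n : ℝ) * 2 ^ i⌋₊ with hg
  have hKpow : ∀ (i : ℤ) (m : ℕ), ∀ᶠ n in (F : Filter ℕ), (m : ℝ) ≤ K n * 2 ^ i := by
    intro i m
    have hpos : (0 : ℝ) < 2 ^ i := zpow_pos two_pos i
    filter_upwards [hK ⌈(m : ℝ) / 2 ^ i⌉₊] with n hn
    rw [← div_le_iff₀ hpos]
    exact (Nat.le_ceil _).trans (Nat.cast_le.2 hn)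
  have hgtop : ∀ i m, ∀ᶠ n in (F : Filter ℕ), m ≤ g i n := fun i m => by
    filter_upwards [hKpow i m] with n hn using Nat.le_floor hn
  have hglt : ∀ i j, i < j → ∀ m, ∀ᶠ n in (F : Filter ℕ), g i n + m ≤ g j n := by
    intro i j hij m
    filter_upwards [hKpow i m] with n hn
    -- Since `K n * 2 ^ i` exceeds any `m`, doubling it makes room for adding `m`.
    refine Nat.le_floor ?_
    have hnn : (0 : ℝ) ≤ K n * 2 ^ i := by positivity
    calc ((g i n + m : ℕ) : ℝ) ≤ K n * 2 ^ i + K n * 2 ^ i := by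
          push_cast
          exact add_le_add (Nat.floor_le hnn) hn
      _ = K n * 2 ^ (i + 1) := by rw [zpow_add_one₀ two_ne_zero]; ring
      _ ≤ K n * 2 ^ j := by
          gcongr
          · exact one_le_two
          · exact hij
  have hu : ∀ (i : ℤ) (n : ℕ), ∃ w : G.WNode, (w ∈ S ∧ w.rank = 0) ∧
      G.scaledDist ρ o w ≤ g i n + 2 ∧ g i n ≤ G.scaledDist ρ o w + 2 ∧
      (i = 0 → G.scaledDist ρ (rep v n) w ≤ 2) := by
    intro i n
    obtain rfl | hi := eq_or_ne i 0
    · obtain ⟨w, hw, hw0, hvw⟩ := exists_zero_node_near hS (rep_mem v n)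
      have h1 := scaledDist_triangle hS ho (rep_mem v n) hw
      have h2 := scaledDist_triangle hS ho hw (rep_mem v n)
      rw [scaledDist_comm w] at h2
      have hg0 : g 0 n = G.scaledDist ρ o (rep v n) := by simp [hg, hKdef]
      exact ⟨w, ⟨hw, hw0⟩, by omega, by omega, fun _ => hvw⟩
    -- For `i > 0` the target can lie beyond `rep v n`; another term `rep v k` is far enough, as `K`
    -- is unbounded.
    · obtain ⟨k, hk⟩ := (hK (g i n)).exists
      obtain ⟨w, hw, hw0, h1, h2⟩ :=
        exists_zero_node_scaledDist hS ho ⟨rep v k, rep_mem v k, hk⟩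
      exact ⟨w, ⟨hw, hw0⟩, h1, h2, fun h => absurd h hi⟩
  choose f hfS hfle hlef hfv using hu
  set U : ℤ → HyperNode F S := fun i => zeroHyperNode F (f i) (hfS i) with hU
  have hrep : ∀ i, ∀ᶠ n in (F : Filter ℕ), rep (U i) n = f i n := fun i =>
    rep_zeroHyperNode (f i) (hfS i)
  have hUnot : ∀ i, U i ∉ (principalGalaxy F S ρ).nodes := by
    intro i hi
    obtain ⟨m, hm⟩ := (mem_principalGalaxy_iff hS ho ho0).1 hi
    obtain ⟨n, h1, h2, h3⟩ := (hm.and ((hrep i).and (hgtop i (m + 3)))).exists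
    rw [h2] at h1
    have := hlef i n
    omega
  have hlt : ∀ i j, i < j → Closer ρ (galaxyOf ρ (U i)) (galaxyOf ρ (U j)) := by
    intro i j hij
    rw [closer_galaxyOf_iff hS ho ho0 (hUnot i) (hUnot j) rfl rfl]
    intro m
    -- The 4 covers the error of 2 at each of the two `0`-nodes; the 5 used below for the converse
    -- just exceeds it.
    filter_upwards [hrep i, hrep j, hglt i j hij (m + 4)] with n hi hj hn
    rw [hi, hj]
    have := hfle i n
    have := hlef j n
    omega
  have hcloser : ∀ i j, Closer ρ (galaxyOf ρ (U i)) (galaxyOf ρ (U j)) ↔ i < j := by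
    refine fun i j => ⟨fun h => ?_, hlt i j⟩
    rw [closer_galaxyOf_iff hS ho ho0 (hUnot i) (hUnot j) rfl rfl] at h
    by_contra! hji
    have hji' : ∀ᶠ n in (F : Filter ℕ), g j n ≤ g i n := by
      obtain rfl | hji := hji.eq_or_lt
      · exact Eventually.of_forall fun _ => le_rfl
      · exact hglt j i hji 0
    obtain ⟨n, h1, h2, h3, h4⟩ := ((h 5).and ((hrep i).and ((hrep j).and hji'))).exists
    rw [h2, h3] at h1
    have := hlef i n
    have := hfle j n
    omega
  refine ⟨fun i => galaxyOf ρ (U i), fun i => ⟨⟨U i, rfl⟩, fun h => hUnot i ?_⟩, fun i j hij => ?_,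
    hcloser, 0, ?_⟩
  · exact h ▸ mem_galaxyOf_self hS (U i)
  · have hij : galaxyOf ρ (U i) = galaxyOf ρ (U j) := hij
    -- Equal galaxies with different indices would give a galaxy closer than itself, against the
    -- irreflexivity of `<`.
    by_contra hne
    obtain h | h := lt_or_gt_of_ne hne
    · have := hlt i j h
      rw [← hij, hcloser] at this
      exact lt_irrefl _ this
    · have := hlt j i h
      rw [hij, hcloser] at this
      exact lt_irrefl _ this
  · refine (limitedlyDistant_iff hS).2 ⟨2, ?_⟩
    filter_upwards [hrep 0] with n hn
    rw [hn, scaledDist_comm]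
    exact hfv 0 n rfl

end Galaxies

end WGraph

end WTheory

theorem theorem5p1 {ν : WTheory.Rank} (G : WTheory.WGraph.{u} ν)
    (F : Ultrafilter ℕ) (hF : (F : Filter ℕ) ≤ Filter.cofinite)
    (ρ : ℕ∞) (hρ : WTheory.Rank.ofIdx ρ ≤ ν)
    (S : Set G.toPreWGraph.WNode) (hS : G.toPreWGraph.IsWSection ρ S) :
    (∀ v : WTheory.HyperNode F S, v ∉ (WTheory.principalGalaxy F S ρ).nodes →
      ∃ Γ : ℤ → WTheory.HyperSubgraph F S,
        (∀ i, WTheory.IsGalaxy ρ (Γ i) ∧ Γ i ≠ WTheory.principalGalaxy F S ρ) ∧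
        Function.Injective Γ ∧
        (∀ i j, WTheory.Closer ρ (Γ i) (Γ j) ↔ i < j) ∧
        ∃ i, v ∈ (Γ i).nodes) ∧
    ((∀ Γ : WTheory.HyperSubgraph F S,
        WTheory.IsGalaxy ρ Γ ↔ Γ = WTheory.principalGalaxy F S ρ) ∨
      {Γ : WTheory.HyperSubgraph F S | WTheory.IsGalaxy ρ Γ}.Infinite) := by
  refine ⟨fun v hv => WTheory.WGraph.exists_int_chain_of_notMem_principalGalaxy hS hv, ?_⟩
  by_cases h : ∀ v : WTheory.HyperNode F S, v ∈ (WTheory.principalGalaxy F S ρ).nodes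
  · refine Or.inl fun Γ => ⟨?_, ?_⟩
    · rintro ⟨x, rfl⟩
      exact WTheory.WGraph.galaxyOf_eq_principalGalaxy hS (h x)
    · rintro rfl
      exact WTheory.WGraph.isGalaxy_principalGalaxy hS
  · push Not at h
    obtain ⟨v, hv⟩ := h
    obtain ⟨Γ, hΓ, hinj, -⟩ := WTheory.WGraph.exists_int_chain_of_notMem_principalGalaxy hS hv
    exact Or.inr (Set.infinite_of_injective_forall_mem hinj fun i => (hΓ i).1)
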